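/- **Conventions.** A pseudovariety of semigroups is a class of finite semigroups closed under subsemigroups, homomorphic images and finitary direct products; $\mathsf S$ is the pseudovariety of all finite semigroups. All alphabets are finite. For a pseudovariety $\mathsf V$ and an alphabet $A$, $\overline{\Omega}_A\mathsf V$ is the free pro-$\mathsf V$ semigroup on $A$ (the inverse limit of the quotients of the free semigroup $A^+$ that belong to $\mathsf V$). The elements of $\overline{\Omega}_A\mathsf S$ are called pseudowords over $A$, and $[\pi]_{\mathsf V}\in\overline{\Omega}_A\mathsf V$ is the image of $\pi\in\overline{\Omega}_A\mathsf S$ under the natural projection. A finite semigroup $S$ satisfies a pseudoidentity $\pi=\rho$, where $\pi,\rho\in\overline{\Omega}_A\mathsf S$, if $\widehat\varphi(\pi)=\widehat\varphi(\rho)$ for every map $\varphi\colon A\to S$, where $\widehat\varphi\colon\overline{\Omega}_A\mathsf S\to S$ is the unique continuous homomorphism extending $\varphi$; $\mathsf V\models\pi=\rho$ means that all semigroups of $\mathsf V$ satisfy $\pi=\rho$. A set $\Sigma$ of pseudoidentities is a basis of $\mathsf V$ if $\mathsf V$ is the class of all finite semigroups that satisfy every element of $\Sigma$. An element $s$ of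 a semigroup $S$ is regular if $s\in sSs$. A pseudoword $\pi$ over $A$ is $\mathsf V$-multiregular if $[\pi]_{\mathsf V}$ is a finite (nonempty) product of regular elements of $\overline{\Omega}_A\mathsf V$. For a semigroup $S$, let $S^I$ be the monoid obtained by adjoining a new identity to $S$, and write $\le_{\mathcal R}$, $\le_{\mathcal L}$ for Green's quasi-orders. Let $\varphi\colon A^+\to S$ be a homomorphism onto a finite semigroup and $\varphi^I\colon A^*\to S^I$ the monoid homomorphism extending it. A good factorization of $x\in A^*$ is a triple $(x_0,a,x_1)\in A^*\times A\times A^*$ with $x=x_0ax_1$, $\varphi^I(x_0a)<_{\mathcal R}\varphi^I(x_0)$ and $\varphi^I(ax_1)<_{\mathcal L}\varphi^I(x_1)$; two good factorizations $(x_0,a,x_1)$, $(y_0,b,y_1)$ are equivalent if $\varphi^I(x_0)=\varphi^I(y_0)$, $a=b$ and $\varphi^I(x_1)=\varphi^I(y_1)$. For $x,y\in A^+$ write $x\sim_\varphi y$ if $\varphi(x)=\varphi(y)$ and each good factorization of $x$ is equivalent to one of $y$, and vice versa. This is a congruence, and $S_\varphi=A^+/{\sim_\varphi}$ is a finite semigroup,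 the Pin–Thérien expansion of $S$ with respect to $\varphi$. The pseudovariety $\mathsf V_{\mathsf{bd}}$ is the one generated by all $S_\varphi$ with $S\in\mathsf V$ and $\varphi\colon A^+\to S$ an onto homomorphism. A language $L\subseteq A^+$ is $\mathsf V$-recognizable if there are $S\in\mathsf V$ and a homomorphism $\varphi\colon A^+\to S$ with $L=\varphi^{-1}(\varphi(L))$. A language $L\subseteq A^*$ is a prefix code if $uA^+\cap L=\emptyset$ for all $u\in L$, and a suffix code if $A^+u\cap L=\emptyset$ for all $u\in L$. The pseudovariety $\mathsf V$ is closed under bideterministic product if, for every alphabet $A$, letter $a\in A$ and languages $L,K$ over $A$, each of which is either a $\mathsf V$-recognizable subset of $A^+$ or the language $\{1\}$, the language $LaK$ is a $\mathsf V$-recognizable subset of $A^+$ whenever $La$ is a prefix code and $aK$ is a suffix code. **Statement.** 1. Let $\mathsf V$ be a pseudovariety of semigroups, $X$ an alphabet, and let $\pi,\rho\in\overline{\Omega}_X\mathsf S$ be $\mathsf V_{\mathsf{bd}}$-multiregular. If $\mathsf V\models\pi=\rho$, then $\mathsf V_{\mathsf{bd}}\models\pi=\rho$. 2. Let $\mathsf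 V$ and $\mathsf W$ be pseudovarieties of semigroups with $\mathsf V\subseteq\mathsf W$, such that $\mathsf V$ has a basis consisting of pseudoidentities $\pi=\rho$ in which both $\pi$ and $\rho$ are $\mathsf W$-multiregular. If $\mathsf W$ is closed under bideterministic product, then so is $\mathsf V$. -/

import Mathlib

open scoped Pointwise

universe u

namespace Bidet

/-! ### Pseudovarieties of semigroups -/

/-- A pseudovariety of semigroups: a class of finite semigroups closed under subsemigroups (up to
isomorphism), homomorphic images and finitary direct products (the empty product is the trivial
semigroup). -/
structure Pseudovariety where
  mem : ∀ (S : Type u) [Semigroup S], Prop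
  finite_of_mem : ∀ (S : Type u) [Semigroup S], mem S → Finite S
  sub_mem : ∀ (S T : Type u) [Semigroup S] [Semigroup T] (f : T →ₙ* S),
    Function.Injective f → mem S → mem T
  image_mem : ∀ (S T : Type u) [Semigroup S] [Semigroup T] (f : S →ₙ* T),
    Function.Surjective f → mem S → mem T
  unit_mem : mem PUnit.{u + 1}
  prod_mem : ∀ (S T : Type u) [Semigroup S] [Semigroup T], mem S → mem T → mem (S × T)

/-- `V ≤ W` means that every member of `V` is a member of `W`. -/
instance : LE Pseudovariety.{u} :=
  ⟨fun V W => ∀ (S : Type u) [Semigroup S], V.mem S → W.mem S⟩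

/-- The pseudovariety `S` of all finite semigroups. -/
def allFinite : Pseudovariety.{u} where
  mem S _ := Finite S
  finite_of_mem _ _ h := h
  sub_mem _ _ _ _ f hf _ := Finite.of_injective f hf
  image_mem _ _ _ _ f hf _ := Finite.of_surjective f hf
  unit_mem := inferInstance
  prod_mem _ _ _ _ h₁ h₂ := by
    have := h₁
    have := h₂
    infer_instance

theorem Pseudovariety.le_allFinite (V : Pseudovariety.{u}) : V ≤ allFinite :=
  fun S _ h => V.finite_of_mem S h

/-! ### Free pro-`V` semigroups -/

/-- The congruences of the free semigroup `A⁺` whose quotient is a member of `V`. -/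
abbrev Pseudovariety.Cong (V : Pseudovariety.{u}) (A : Type u) : Type u :=
  {c : Con (FreeSemigroup A) // V.mem c.Quotient}

/-- The free pro-`V` semigroup on the alphabet `A`, constructed as the inverse limit of the
quotients of `A⁺` that are members of `V`: an element is a family of elements of these quotients
that is compatible with the projections between them. -/
@[ext]
structure FreePro (V : Pseudovariety.{u}) (A : Type u) : Type u where
  val : ∀ c : V.Cong A, c.1.Quotient
  compat : ∀ c d : V.Cong A, c.1 ≤ d.1 → ∀ w : FreeSemigroup A,
    val c = (w : c.1.Quotient) → val d = (w : d.1.Quotient)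

namespace FreePro

variable {V : Pseudovariety.{u}} {A : Type u}

/-- The multiplication is componentwise. -/
instance : Semigroup (FreePro V A) where
  mul x y := ⟨fun c => x.1 c * y.1 c, by
    intro c d h w hw
    obtain ⟨a, ha⟩ := Quot.exists_rep (x.1 c)
    obtain ⟨b, hb⟩ := Quot.exists_rep (y.1 c)
    have ha' : x.1 c = (a : c.1.Quotient) := ha.symm
    have hb' : y.1 c = (b : c.1.Quotient) := hb.symm
    change x.1 c * y.1 c = _ at hw
    change x.1 d * y.1 d = _
    rw [ha', hb', ← Con.coe_mul, Con.eq] at hw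
    rw [x.2 c d h a ha', y.2 c d h b hb', ← Con.coe_mul, Con.eq]
    exact h hw⟩
  mul_assoc x y z := FreePro.ext (funext fun c => mul_assoc (x.1 c) (y.1 c) (z.1 c))

/-- The topology of the inverse limit, the finite quotients being discrete: the coarsest topology
for which all the components are continuous. -/
instance : TopologicalSpace (FreePro V A) :=
  ⨅ c : V.Cong A, TopologicalSpace.induced (fun x : FreePro V A => x.1 c) ⊥

/-- The canonical homomorphism from `A⁺` to the free pro-`V` semigroup on `A`. -/
def ofWord (V : Pseudovariety.{u}) {A : Type u} : FreeSemigroup A →ₙ* FreePro V A where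
  toFun w := ⟨fun c => (w : c.1.Quotient), by
    intro c d h v hv
    rw [Con.eq] at hv ⊢
    exact h hv⟩
  map_mul' _ _ := rfl

/-- The canonical map from the alphabet to the free pro-`V` semigroup. -/
def ι (V : Pseudovariety.{u}) {A : Type u} (a : A) : FreePro V A :=
  ofWord V (FreeSemigroup.of a)

/-- The kernel of a homomorphism from `A⁺` into a member of `V`. -/
def kerCong {S : Type u} [Semigroup S] (hS : V.mem S) (f : FreeSemigroup A →ₙ* S) : V.Cong A :=
  ⟨Con.ker f, V.sub_mem S _
    { toFun := fun q => Con.liftOn q f fun _ _ h => h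
      map_mul' := fun p q => by
        induction p, q using Con.induction_on₂ with
        | _ a b => exact map_mul f a b }
    (fun p q => by
      induction p, q using Con.induction_on₂ with
      | _ a b => exact fun h => (Con.eq _).2 h) hS⟩

/-- The homomorphism `φ̂` from the free pro-`V` semigroup on `A` to the member `S` of `V` that
is induced by a map `φ : A → S`. It is the unique continuous homomorphism extending `φ`,
see `lift_ι`, `isOpen_lift_fiber` and `lift_unique`. -/
def lift {S : Type u} [Semigroup S] (hS : V.mem S) (φ : A → S) : FreePro V A →ₙ* S where
  toFun x := Con.liftOn (x.1 (kerCong hS (FreeSemigroup.lift φ))) (FreeSemigroup.lift φ)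
    fun _ _ h => h
  map_mul' x y := by
    change Con.liftOn (x.1 _ * y.1 _) _ _ = _
    induction x.1 (kerCong hS (FreeSemigroup.lift φ)),
      y.1 (kerCong hS (FreeSemigroup.lift φ)) using Con.induction_on₂ with
    | _ a b => exact map_mul (FreeSemigroup.lift φ) a b

theorem lift_ofWord {S : Type u} [Semigroup S] (hS : V.mem S) (φ : A → S)
    (w : FreeSemigroup A) : lift hS φ (ofWord V w) = FreeSemigroup.lift φ w := rfl

theorem lift_ι {S : Type u} [Semigroup S] (hS : V.mem S) (φ : A → S) (a : A) :
    lift hS φ (ι V a) = φ a := by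
  rw [ι, lift_ofWord, FreeSemigroup.lift_of]

theorem isOpen_component (c : V.Cong A) (U : Set c.1.Quotient) :
    IsOpen {x : FreePro V A | x.1 c ∈ U} :=
  (iInf_le (fun c : V.Cong A =>
    TopologicalSpace.induced (fun x : FreePro V A => x.1 c) ⊥) c) _ ⟨U, trivial, rfl⟩

/-- `φ̂` is continuous for the discrete topology of `S`. -/
theorem isOpen_lift_fiber {S : Type u} [Semigroup S] (hS : V.mem S) (φ : A → S) (U : Set S) :
    IsOpen (lift hS φ ⁻¹' U) :=
  isOpen_component (kerCong hS (FreeSemigroup.lift φ))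
    {q | Con.liftOn q (FreeSemigroup.lift φ) (fun _ _ h => h) ∈ U}

theorem inf_mem (c d : V.Cong A) : V.mem (c.1 ⊓ d.1).Quotient :=
  V.sub_mem _ _
    { toFun := fun q => Con.liftOn q
        (fun w => ((w : c.1.Quotient), (w : d.1.Quotient)))
        (fun _ _ h => Prod.ext ((Con.eq _).2 h.1) ((Con.eq _).2 h.2))
      map_mul' := fun p q => by
        induction p, q using Con.induction_on₂ with
        | _ a b => rfl }
    (fun p q => by
      induction p, q using Con.induction_on₂ with
      | _ a b =>
        intro h
        exact (Con.eq _).2 ⟨(Con.eq _).1 (congrArg Prod.fst h),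
          (Con.eq _).1 (congrArg Prod.snd h)⟩)
    (V.prod_mem _ _ c.2 d.2)

theorem top_mem [Nonempty A] : V.mem (⊤ : Con (FreeSemigroup A)).Quotient :=
  V.sub_mem _ _ { toFun := fun _ => PUnit.unit, map_mul' := fun _ _ => rfl }
    (fun p q => by
      induction p, q using Con.induction_on₂ with
      | _ a b => exact fun _ => (Con.eq _).2 trivial) V.unit_mem

/-- The image of `A⁺` is dense in the free pro-`V` semigroup. -/
theorem dense_range_ofWord : Dense (Set.range (ofWord V (A := A))) := by
  intro x
  rw [mem_closure_iff_nhds]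
  have key : ∀ s : Finset (V.Cong A), ∃ c : V.Cong A, ∀ d ∈ s, c.1 ≤ d.1 := by
    classical
    intro s
    induction s using Finset.induction_on with
    | empty =>
      rcases isEmpty_or_nonempty A with hA | hA
      · have : IsEmpty (FreeSemigroup A) := ⟨fun w => hA.elim w.head⟩
        refine ⟨⟨⊤, V.sub_mem PUnit _
          { toFun := fun _ => PUnit.unit, map_mul' := fun _ _ => rfl } (fun p q => ?_)
          V.unit_mem⟩, by simp⟩
        obtain ⟨a, -⟩ := Quot.exists_rep p
        exact (this.false a).elim
      · exact ⟨⟨⊤, top_mem⟩, by simp⟩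
    | insert d s _ ih =>
      obtain ⟨c, hc⟩ := ih
      refine ⟨⟨_, inf_mem c d⟩, fun e he => ?_⟩
      rcases Finset.mem_insert.1 he with rfl | he
      · exact inf_le_right
      · exact inf_le_left.trans (hc e he)
  intro t ht
  rw [nhds_iInf, Filter.mem_iInf'] at ht
  obtain ⟨I, hI, W, hW, -, rfl, -⟩ := ht
  obtain ⟨c, hc⟩ := key hI.toFinset
  obtain ⟨w, hw⟩ := Quot.exists_rep (x.1 c)
  refine ⟨ofWord V w, ?_, w, rfl⟩
  simp only [Set.mem_iInter]
  intro d hd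
  have h1 := hW d
  rw [@nhds_induced _ _ ⊥, Filter.mem_comap] at h1
  obtain ⟨U, hU, hUW⟩ := h1
  apply hUW
  have h2 : x.1 d = (w : d.1.Quotient) :=
    x.2 c d (hc d (hI.mem_toFinset.2 hd)) w hw.symm
  change ((w : d.1.Quotient)) ∈ U
  rw [← h2]
  exact @mem_of_mem_nhds _ ⊥ _ _ hU

/-- `φ̂` is the only continuous homomorphism extending `φ`. -/
theorem lift_unique {S : Type u} [Semigroup S] (hS : V.mem S) (φ : A → S)
    (ψ : FreePro V A →ₙ* S) (hc : ∀ U : Set S, IsOpen (ψ ⁻¹' U)) (hψ : ∀ a, ψ (ι V a) = φ a) :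
    ψ = lift hS φ := by
  ext x
  have hw : ψ.comp (ofWord V) = FreeSemigroup.lift φ := by
    apply FreeSemigroup.hom_ext
    funext a
    simpa [ι] using hψ a
  obtain ⟨y, ⟨h1, h2⟩, w, rfl⟩ := (mem_closure_iff.1 (dense_range_ofWord x))
    (ψ ⁻¹' {ψ x} ∩ lift hS φ ⁻¹' {lift hS φ x})
    ((hc _).inter (isOpen_lift_fiber hS φ _)) ⟨rfl, rfl⟩
  rw [← show _ = ψ x from h1, ← show _ = lift hS φ x from h2, lift_ofWord, ← hw]
  rfl

end FreePro

/-! ### Pseudowords and pseudoidentities -/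

/-- Pseudowords over `A`: the elements of the free profinite semigroup on `A`. -/
abbrev Pseudoword (A : Type u) : Type u := FreePro allFinite.{u} A

/-- The natural projection `π ↦ [π]_V` of the free profinite semigroup on `A` onto the free
pro-`V` semigroup on `A`. -/
def proj (V : Pseudovariety.{u}) {A : Type u} : Pseudoword A →ₙ* FreePro V A where
  toFun x := ⟨fun c => x.1 ⟨c.1, V.le_allFinite _ c.2⟩, fun c d h w hw =>
    x.2 ⟨c.1, V.le_allFinite _ c.2⟩ ⟨d.1, V.le_allFinite _ d.2⟩ h w hw⟩
  map_mul' _ _ := rfl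

/-- The finite semigroup `S` satisfies the pseudoidentity `π = ρ`. -/
def Models (S : Type u) [Semigroup S] [hS : Finite S] {A : Type u} (π ρ : Pseudoword A) : Prop :=
  ∀ φ : A → S, FreePro.lift (V := allFinite) hS φ π = FreePro.lift (V := allFinite) hS φ ρ

/-- All the semigroups of `V` satisfy the pseudoidentity `π = ρ`. -/
def Pseudovariety.Models (V : Pseudovariety.{u}) {A : Type u} (π ρ : Pseudoword A) : Prop :=
  ∀ (S : Type u) [Semigroup S] [Finite S], V.mem S → Bidet.Models S π ρ

/-- A pseudoidentity: a formal equality of two pseudowords over the same finite alphabet. -/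
structure Pseudoidentity where
  alphabet : Type u
  finite_alphabet : Finite alphabet
  lhs : Pseudoword alphabet
  rhs : Pseudoword alphabet

/-- `Σ` is a basis of `V`: the members of `V` are exactly the finite semigroups that satisfy all
the pseudoidentities of `Σ`. -/
def IsBasis (E : Set Pseudoidentity.{u}) (V : Pseudovariety.{u}) : Prop :=
  ∀ (S : Type u) [Semigroup S],
    V.mem S ↔ ∃ _ : Finite S, ∀ e ∈ E, Models S e.lhs e.rhs

/-- An element `s` of a semigroup `S` is regular when `s ∈ sSs`. -/
def IsRegularElt {S : Type u} [Semigroup S] (s : S) : Prop := ∃ t : S, s = s * t * s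

/-- A pseudoword `π` is `V`-multiregular when `[π]_V` is a finite (nonempty) product of regular
elements of the free pro-`V` semigroup. -/
def IsMultiregular (V : Pseudovariety.{u}) {A : Type u} (π : Pseudoword A) : Prop :=
  proj V π ∈ Subsemigroup.closure {s : FreePro V A | IsRegularElt s}

/-- `V` has a basis of pseudoidentities between `W`-multiregular pseudowords. -/
def MultiregularlyBasedIn (V W : Pseudovariety.{u}) : Prop :=
  ∃ E : Set Pseudoidentity.{u}, IsBasis E V ∧
    ∀ e ∈ E, IsMultiregular W e.lhs ∧ IsMultiregular W e.rhs

/-! ### The Pin–Thérien expansion -/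

section Green

variable {M : Type u} [Semigroup M]

/-- `s ≤_R t`, that is, `s ∈ t Mᴵ`. -/
def LeR (s t : M) : Prop := s = t ∨ ∃ m : M, s = t * m

/-- `s ≤_L t`, that is, `s ∈ Mᴵ t`. -/
def LeL (s t : M) : Prop := s = t ∨ ∃ m : M, s = m * t

/-- `s <_R t`. -/
def LtR (s t : M) : Prop := LeR s t ∧ ¬ LeR t s

/-- `s <_L t`. -/
def LtL (s t : M) : Prop := LeL s t ∧ ¬ LeL t s

end Green

section MonoidExpansion

variable {A M : Type u} [Monoid M]

/-- `(x₀, a, x₁)` is a good factorization with respect to `f : A* → M`. -/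
def IsGoodFactorization (f : FreeMonoid A →* M) (x₀ : FreeMonoid A) (a : A)
    (x₁ : FreeMonoid A) : Prop :=
  LtR (f (x₀ * FreeMonoid.of a)) (f x₀) ∧ LtL (f (FreeMonoid.of a * x₁)) (f x₁)

/-- Each good factorization of `x` is equivalent to a good factorization of `y`. -/
def GoodLE (f : FreeMonoid A →* M) (x y : FreeMonoid A) : Prop :=
  ∀ (x₀ : FreeMonoid A) (a : A) (x₁ : FreeMonoid A),
    IsGoodFactorization f x₀ a x₁ → x = x₀ * FreeMonoid.of a * x₁ →
      ∃ y₀ y₁ : FreeMonoid A, IsGoodFactorization f y₀ a y₁ ∧ y = y₀ * FreeMonoid.of a * y₁ ∧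
        f x₀ = f y₀ ∧ f x₁ = f y₁

theorem split_mul {x z x₀ x₁ : FreeMonoid A} {a : A} (h : x * z = x₀ * FreeMonoid.of a * x₁) :
    (∃ t, x₀ = x * t ∧ z = t * FreeMonoid.of a * x₁) ∨
      ∃ t, x = x₀ * FreeMonoid.of a * t ∧ x₁ = t * z := by
  have h' : (FreeMonoid.toList x) ++ FreeMonoid.toList z =
      FreeMonoid.toList x₀ ++ (a :: FreeMonoid.toList x₁) := by
    have := congrArg FreeMonoid.toList h
    simpa [FreeMonoid.toList_mul] using this
  rcases List.append_eq_append_iff.1 h' with ⟨t, h1, h2⟩ | ⟨t, h1, h2⟩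
  · left
    refine ⟨FreeMonoid.ofList t, FreeMonoid.toList.injective (by simpa using h1),
      FreeMonoid.toList.injective (by simpa using h2)⟩
  · cases t with
    | nil =>
      left
      refine ⟨1, FreeMonoid.toList.injective (by simpa using h1.symm),
        FreeMonoid.toList.injective (by simpa using h2.symm)⟩
    | cons b t =>
      right
      simp only [List.cons_append, List.cons.injEq] at h2
      obtain ⟨rfl, h2⟩ := h2
      refine ⟨FreeMonoid.ofList t, FreeMonoid.toList.injective (by simpa using h1),
        FreeMonoid.toList.injective (by simpa using h2)⟩

theorem IsGoodFactorization.congr {f : FreeMonoid A →* M} {x₀ y₀ x₁ y₁ : FreeMonoid A} {a : A}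
    (h : IsGoodFactorization f x₀ a x₁) (h₀ : f x₀ = f y₀) (h₁ : f x₁ = f y₁) :
    IsGoodFactorization f y₀ a y₁ := by
  simpa only [IsGoodFactorization, map_mul, h₀, h₁] using h

theorem IsGoodFactorization.of_mul_right {f : FreeMonoid A →* M} {x₀ x₁ z : FreeMonoid A} {a : A}
    (h : IsGoodFactorization f x₀ a (x₁ * z)) : IsGoodFactorization f x₀ a x₁ := by
  refine ⟨h.1, Or.inr ⟨f (FreeMonoid.of a), map_mul _ _ _⟩, fun h' => h.2.2 ?_⟩
  rcases h' with h' | ⟨m, h'⟩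
  · left
    rw [← mul_assoc, map_mul, map_mul f (_ * _), ← h']
  · right
    refine ⟨m, ?_⟩
    rw [← mul_assoc, map_mul, map_mul f (_ * _), ← mul_assoc, ← h']

theorem IsGoodFactorization.of_mul_left {f : FreeMonoid A →* M} {x₀ x₁ z : FreeMonoid A} {a : A}
    (h : IsGoodFactorization f (z * x₀) a x₁) : IsGoodFactorization f x₀ a x₁ := by
  refine ⟨⟨Or.inr ⟨f (FreeMonoid.of a), map_mul _ _ _⟩, fun h' => h.1.2 ?_⟩, h.2⟩
  rcases h' with h' | ⟨m, h'⟩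
  · left
    rw [mul_assoc, map_mul, map_mul f z (_ * _), ← h']
  · right
    refine ⟨m, ?_⟩
    rw [mul_assoc, map_mul, map_mul f z (_ * _), mul_assoc, ← h']

theorem GoodLE.mul_right {f : FreeMonoid A →* M} {x y : FreeMonoid A} (h : GoodLE f x y)
    (hf : f x = f y) (z : FreeMonoid A) : GoodLE f (x * z) (y * z) := by
  intro x₀ a x₁ hg hx
  rcases split_mul hx with ⟨t, rfl, rfl⟩ | ⟨t, rfl, rfl⟩
  · have e : f (x * t) = f (y * t) := by rw [map_mul, map_mul, hf]
    exact ⟨y * t, x₁, hg.congr e rfl, by simp only [mul_assoc], e, rfl⟩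
  · obtain ⟨y₀, y₁, _, rfl, e₀, e₁⟩ := h x₀ a t hg.of_mul_right rfl
    have e : f (t * z) = f (y₁ * z) := by rw [map_mul, map_mul, e₁]
    exact ⟨y₀, y₁ * z, hg.congr e₀ e, by simp only [mul_assoc], e₀, e⟩

theorem GoodLE.mul_left {f : FreeMonoid A →* M} {x y : FreeMonoid A} (h : GoodLE f x y)
    (hf : f x = f y) (z : FreeMonoid A) : GoodLE f (z * x) (z * y) := by
  intro x₀ a x₁ hg hx
  rcases split_mul hx with ⟨t, rfl, rfl⟩ | ⟨t, rfl, rfl⟩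
  · obtain ⟨y₀, y₁, _, rfl, e₀, e₁⟩ := h t a x₁ hg.of_mul_left rfl
    have e : f (z * t) = f (z * y₀) := by rw [map_mul, map_mul, e₀]
    exact ⟨z * y₀, y₁, hg.congr e e₁, by simp only [mul_assoc], e, e₁⟩
  · have e : f (t * x) = f (t * y) := by rw [map_mul, map_mul, hf]
    exact ⟨x₀, t * y, hg.congr rfl e, by simp only [mul_assoc], rfl, e⟩

theorem GoodLE.trans {f : FreeMonoid A →* M} {x y z : FreeMonoid A} (h : GoodLE f x y)
    (h' : GoodLE f y z) : GoodLE f x z := by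
  intro x₀ a x₁ hg hx
  obtain ⟨y₀, y₁, hg', hy, e₀, e₁⟩ := h x₀ a x₁ hg hx
  obtain ⟨z₀, z₁, hg'', hz, e₀', e₁'⟩ := h' y₀ a y₁ hg' hy
  exact ⟨z₀, z₁, hg'', hz, e₀.trans e₀', e₁.trans e₁'⟩

/-- The congruence `∼_f` of `A*`: `x ∼_f y` when `f x = f y`, each good factorization of `x` is
equivalent to a good factorization of `y`, and each good factorization of `y` is equivalent to a
good factorization of `x`. -/
def ptCon (f : FreeMonoid A →* M) : Con (FreeMonoid A) where
  r x y := f x = f y ∧ GoodLE f x y ∧ GoodLE f y x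
  iseqv :=
    { refl := fun x => ⟨rfl, fun x₀ _ x₁ h h' => ⟨x₀, x₁, h, h', rfl, rfl⟩,
        fun x₀ _ x₁ h h' => ⟨x₀, x₁, h, h', rfl, rfl⟩⟩
      symm := fun h => ⟨h.1.symm, h.2.2, h.2.1⟩
      trans := fun h h' => ⟨h.1.trans h'.1, h.2.1.trans h'.2.1, h'.2.2.trans h.2.2⟩ }
  mul' := by
    intro w x y z h h'
    refine ⟨by rw [map_mul, map_mul, h.1, h'.1], ?_, ?_⟩
    · exact (h.2.1.mul_right h.1 y).trans (h'.2.1.mul_left h'.1 x)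
    · exact (h'.2.2.mul_left h'.1.symm x).trans (h.2.2.mul_right h.1.symm y)

end MonoidExpansion

/-- The extension `φᴵ : A* → Sᴵ` of a semigroup homomorphism `φ : A⁺ → S`. -/
def extI {A S : Type u} [Semigroup S] (φ : FreeSemigroup A →ₙ* S) : FreeMonoid A →* WithOne S :=
  FreeMonoid.lift fun a => (φ (FreeSemigroup.of a) : WithOne S)

theorem extI_toFreeMonoid {A S : Type u} [Semigroup S] (φ : FreeSemigroup A →ₙ* S)
    (w : FreeSemigroup A) : extI φ (FreeSemigroup.toFreeMonoid w) = (φ w : WithOne S) := by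
  induction w using FreeSemigroup.recOnMul with
  | ih1 a => simp [extI]
  | ih2 a b h h' => rw [map_mul, map_mul, h, h', map_mul, WithOne.coe_mul]

/-- The congruence `∼_φ` of `A⁺`, the restriction to `A⁺` of the congruence of `A*` that is
associated with `φᴵ`. -/
def ptConSemigroup {A S : Type u} [Semigroup S] (φ : FreeSemigroup A →ₙ* S) :
    Con (FreeSemigroup A) :=
  (ptCon (extI φ)).comap FreeSemigroup.toFreeMonoid (map_mul _)

/-- The (semigroup) Pin–Thérien expansion `S_φ = A⁺/∼_φ`. -/
abbrev PTExpansion {A S : Type u} [Semigroup S] (φ : FreeSemigroup A →ₙ* S) : Type u :=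
  (ptConSemigroup φ).Quotient

theorem finite_ptExpansion {A S : Type u} [Finite A] [Semigroup S] [Finite S]
    (φ : FreeSemigroup A →ₙ* S) : Finite (PTExpansion φ) := by
  have : Finite (WithOne S) := inferInstanceAs (Finite (Option S))
  let f := extI φ
  let F : FreeSemigroup A → WithOne S × Set (WithOne S × A × WithOne S) := fun w =>
    (f w.toFreeMonoid, {p | ∃ x₀ x₁, IsGoodFactorization f x₀ p.2.1 x₁ ∧
      w.toFreeMonoid = x₀ * FreeMonoid.of p.2.1 * x₁ ∧ p.1 = f x₀ ∧ p.2.2 = f x₁})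
  have hF : ∀ v w, F v = F w → GoodLE f v.toFreeMonoid w.toFreeMonoid := by
    intro v w h x₀ a x₁ hg hx
    have h2 : (f x₀, a, f x₁) ∈ (F w).2 := h ▸ ⟨x₀, x₁, hg, hx, rfl, rfl⟩
    obtain ⟨y₀, y₁, hg', hy, e₀, e₁⟩ := h2
    exact ⟨y₀, y₁, hg', hy, e₀, e₁⟩
  refine Finite.of_injective (fun q : PTExpansion φ => F (Quot.out q)) fun p q h => ?_
  have h' : F (Quot.out p) = F (Quot.out q) := h
  rw [← Quot.out_eq p, ← Quot.out_eq q]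
  exact Quot.sound ⟨congrArg Prod.fst h', hF _ _ h', hF _ _ h'.symm⟩

/-- `W` contains the Pin–Thérien expansions of all semigroups of `V`, with respect to all onto
homomorphisms `φ : A⁺ → S` with `A` a finite alphabet and `S` a member of `V`. -/
def ContainsExpansions (V W : Pseudovariety.{u}) : Prop :=
  ∀ (A : Type u) [Finite A] (S : Type u) [Semigroup S] (φ : FreeSemigroup A →ₙ* S),
    V.mem S → Function.Surjective φ → W.mem (PTExpansion φ)

/-- `V_bd`, the pseudovariety generated by the Pin–Thérien expansions of semigroups of `V`, that
is, the least pseudovariety that contains all these expansions. -/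
def Pseudovariety.bd (V : Pseudovariety.{u}) : Pseudovariety.{u} where
  mem T _ := ∀ W : Pseudovariety.{u}, ContainsExpansions V W → W.mem T
  finite_of_mem T _ h := h allFinite fun A _ S _ φ hS _ => by
    have := V.finite_of_mem S hS
    exact finite_ptExpansion φ
  sub_mem S T _ _ f hf h W hW := W.sub_mem S T f hf (h W hW)
  image_mem S T _ _ f hf h W hW := W.image_mem S T f hf (h W hW)
  unit_mem W _ := W.unit_mem
  prod_mem S T _ _ h h' W hW := W.prod_mem S T (h W hW) (h' W hW)

/-! ### Closure under bideterministic product -/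

/-- A language of `A⁺` is `V`-recognizable. -/
def Recognizable (V : Pseudovariety.{u}) {A : Type u} (L : Set (FreeSemigroup A)) : Prop :=
  ∃ (S : Type u) (_ : Semigroup S) (φ : FreeSemigroup A →ₙ* S), V.mem S ∧ L = φ ⁻¹' (φ '' L)

/-- A language of `A*` that is contained in `A⁺` and is `V`-recognizable as a language of `A⁺`. -/
def PlusRecognizable (V : Pseudovariety.{u}) {A : Type u} (L : Set (FreeMonoid A)) : Prop :=
  ∃ L' : Set (FreeSemigroup A), Recognizable V L' ∧ L = FreeSemigroup.toFreeMonoid '' L'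

/-- `uA⁺ ∩ L = ∅` for every `u ∈ L`. -/
def IsPrefixCode {A : Type u} (L : Set (FreeMonoid A)) : Prop :=
  ∀ u ∈ L, ∀ w : FreeSemigroup A, u * w.toFreeMonoid ∉ L

/-- `A⁺u ∩ L = ∅` for every `u ∈ L`. -/
def IsSuffixCode {A : Type u} (L : Set (FreeMonoid A)) : Prop :=
  ∀ u ∈ L, ∀ w : FreeSemigroup A, w.toFreeMonoid * u ∉ L

/-- `V` is closed under bideterministic product: if each of `L` and `K` is a `V`-recognizable
`+`-language or the language `{1}`, if `a` is a letter, `La` is a prefix code and `aK` is a suffix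
code, then `LaK` is `V`-recognizable. -/
def ClosedUnderBideterministicProduct (V : Pseudovariety.{u}) : Prop :=
  ∀ (A : Type u) [Finite A] (L K : Set (FreeMonoid A)) (a : A),
    (PlusRecognizable V L ∨ L = {1}) → (PlusRecognizable V K ∨ K = {1}) →
    IsPrefixCode (L * {FreeMonoid.of a}) → IsSuffixCode ({FreeMonoid.of a} * K) →
    PlusRecognizable V (L * {FreeMonoid.of a} * K)

end Bidet

/-! Both statements rest on one principle: products of regular elements are blind to the extra
information that separates a larger semigroup from a base semigroup in which the pseudoidentity
already holds.

For the first statement, the extra information in an expansion `PTExpansion φ` is the set of good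
factorizations. A word whose class is regular has none, because `w ∼ wtw` lets one undo the drop in
`≤_R` or `≤_L` at the marked letter (`not_hasGoodFactorization_mul_mul`), and a good factorization
of a product restricts to one of a factor. So the projection to `S` is injective on products of
regular elements (`PTExpansion.eq_of_mem_closure`), and an equality valid in `S` lifts.

For the second, the larger semigroup is the syntactic semigroup of `LaK`, a member of `W`. The extra
information is whether, in a context `p _ q`, the marked letter `a` lies inside the word. The code
hypotheses make this invariant under syntactic equivalence (`HasInnerFactorization.congr`) and, by a
length count, impossible for regular classes. With the marked letter outside, membership in `LaK`
depends only on the class of the word for `L` or for `K`, hence on its value in a product of members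
of `V` (`models_syntacticCon_product`). -/

namespace Bidet

/-! ### Evaluation of pseudowords and classes defined by pseudoidentities. -/

namespace FreePro

variable {V : Pseudovariety.{u}} {A : Type u}

/-- The values of `φ̂` are values at words. -/
theorem exists_word_lift {S : Type u} [Semigroup S] (hS : V.mem S) (φ : A → S) (x : FreePro V A) :
    ∃ w : FreeSemigroup A, lift hS φ x = FreeSemigroup.lift φ w := by
  obtain ⟨w, hw⟩ := Quot.exists_rep (x.1 (kerCong hS (FreeSemigroup.lift φ)))
  refine ⟨w, ?_⟩
  change Con.liftOn (x.1 (kerCong hS (FreeSemigroup.lift φ))) _ _ = _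
  rw [← hw]
  rfl

/-- Continuous homomorphic extensions commute with homomorphisms of members of `V`. -/
theorem map_lift {S T : Type u} [Semigroup S] [Semigroup T] (hS : V.mem S) (hT : V.mem T)
    (f : S →ₙ* T) (φ : A → S) (ψ : A → T) (h : ∀ a, f (φ a) = ψ a) (x : FreePro V A) :
    f (lift hS φ x) = lift hT ψ x := by
  -- Both sides are continuous and agree on the letters, so uniqueness of the extension applies.
  have := lift_unique hT ψ (f.comp (lift hS φ))
    (fun U => isOpen_lift_fiber hS φ (f ⁻¹' U)) (fun a => by
      rw [MulHom.comp_apply, lift_ι, h])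
  rw [← this, MulHom.comp_apply]

end FreePro

theorem lift_proj (V : Pseudovariety.{u}) {A S : Type u} [Semigroup S] (hS : V.mem S)
    (hf : Finite S) (φ : A → S) (π : Pseudoword A) :
    FreePro.lift hS φ (proj V π) = FreePro.lift (V := allFinite) hf φ π := rfl

theorem IsRegularElt.map {S T : Type u} [Semigroup S] [Semigroup T] (f : S →ₙ* T) {s : S}
    (h : IsRegularElt s) : IsRegularElt (f s) := by
  obtain ⟨t, ht⟩ := h
  exact ⟨f t, by rw [← map_mul, ← map_mul, ← ht]⟩

/-- The values of a `V`-multiregular pseudoword in members of `V` are products of regular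
elements. -/
theorem IsMultiregular.lift_mem {V : Pseudovariety.{u}} {A : Type u} {π : Pseudoword A}
    (h : IsMultiregular V π) {S : Type u} [Semigroup S] (hS : V.mem S) (hf : Finite S)
    (φ : A → S) :
    FreePro.lift (V := allFinite) hf φ π ∈ Subsemigroup.closure {s : S | IsRegularElt s} := by
  -- Evaluation in a member of `V` factors through the free pro-`V` semigroup, where the product of
  -- regular elements is given; homomorphisms preserve such products.
  rw [← lift_proj V hS hf]
  have h' := Subsemigroup.mem_map_of_mem (FreePro.lift hS φ) h
  rw [MulHom.map_mclosure] at h'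
  refine Subsemigroup.closure_mono ?_ h'
  rintro _ ⟨s, hs, rfl⟩
  exact hs.map _

theorem Models.of_injective {S T : Type u} [Semigroup S] [Semigroup T] [Finite S] [Finite T]
    {A : Type u} {π ρ : Pseudoword A} (f : T →ₙ* S) (hf : Function.Injective f)
    (h : Models S π ρ) : Models T π ρ := by
  intro φ
  apply hf
  have := fun x => FreePro.map_lift (V := allFinite) ‹Finite T› ‹Finite S› f φ _ (fun _ => rfl) x
  rw [this, this]
  exact h _

theorem Models.of_surjective {S T : Type u} [Semigroup S] [Semigroup T] [Finite S] [Finite T]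
    {A : Type u} {π ρ : Pseudoword A} (f : S →ₙ* T) (hf : Function.Surjective f)
    (h : Models S π ρ) : Models T π ρ := by
  intro φ
  have := fun x => FreePro.map_lift (V := allFinite) ‹Finite S› ‹Finite T› f
    (Function.surjInv hf ∘ φ) φ (fun a => Function.surjInv_eq hf _) x
  rw [← this, ← this, h]

theorem Models.prod {S T : Type u} [Semigroup S] [Semigroup T] [Finite S] [Finite T]
    {A : Type u} {π ρ : Pseudoword A} (hS : Models S π ρ) (hT : Models T π ρ) :
    Models (S × T) π ρ := by
  intro φ
  have h₁ := fun x => FreePro.map_lift (V := allFinite)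
    (inferInstanceAs (Finite (S × T))) ‹Finite S› (MulHom.fst S T) φ _ (fun _ => rfl) x
  have h₂ := fun x => FreePro.map_lift (V := allFinite)
    (inferInstanceAs (Finite (S × T))) ‹Finite T› (MulHom.snd S T) φ _ (fun _ => rfl) x
  exact Prod.ext ((h₁ π).trans ((hS _).trans (h₁ ρ).symm))
    ((h₂ π).trans ((hT _).trans (h₂ ρ).symm))

/-- The pseudovariety of all finite semigroups that satisfy a pseudoidentity. -/
def modelsPseudovariety {A : Type u} (π ρ : Pseudoword A) : Pseudovariety.{u} where
  mem S _ := ∃ _ : Finite S, Models S π ρ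
  finite_of_mem _ _ h := h.1
  sub_mem S T _ _ f hf h := by
    obtain ⟨hS, h⟩ := h
    have := Finite.of_injective f hf
    exact ⟨this, h.of_injective f hf⟩
  image_mem S T _ _ f hf h := by
    obtain ⟨hS, h⟩ := h
    have := Finite.of_surjective f hf
    exact ⟨this, h.of_surjective f hf⟩
  unit_mem := ⟨inferInstance, fun _ => rfl⟩
  prod_mem S T _ _ h₁ h₂ := by
    obtain ⟨hS, h₁⟩ := h₁
    obtain ⟨hT, h₂⟩ := h₂
    exact ⟨inferInstance, h₁.prod h₂⟩

/-! ### Good factorizations and regular elements -/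

section Expansion

variable {A M : Type u} [Monoid M]

/-- The word `x` admits a good factorization. -/
def HasGoodFactorization (f : FreeMonoid A →* M) (x : FreeMonoid A) : Prop :=
  ∃ x₀ a x₁, IsGoodFactorization f x₀ a x₁ ∧ x = x₀ * FreeMonoid.of a * x₁

theorem GoodLE.hasGoodFactorization {f : FreeMonoid A →* M} {x y : FreeMonoid A}
    (h : GoodLE f x y) (hx : HasGoodFactorization f x) : HasGoodFactorization f y := by
  obtain ⟨x₀, a, x₁, hg, hx⟩ := hx
  obtain ⟨y₀, y₁, hg', hy, -⟩ := h x₀ a x₁ hg hx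
  exact ⟨y₀, a, y₁, hg', hy⟩

/-- The marked letter lies in one of the two factors, and strict descents survive there: translating
an `≤_R`-equivalence on the left, or an `≤_L`-equivalence on the right, preserves it, so a step that
is strict in the longer context was already strict in the shorter one. -/
theorem HasGoodFactorization.of_mul {f : FreeMonoid A →* M} {x y : FreeMonoid A}
    (h : HasGoodFactorization f (x * y)) :
    HasGoodFactorization f x ∨ HasGoodFactorization f y := by
  obtain ⟨x₀, a, x₁, hg, hx⟩ := h
  rcases split_mul hx with ⟨t, rfl, rfl⟩ | ⟨t, rfl, rfl⟩
  · exact Or.inr ⟨t, a, x₁, hg.of_mul_left, rfl⟩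
  · exact Or.inl ⟨x₀, a, t, hg.of_mul_right, rfl⟩

/-- If the marked letter comes after the first `w`, then `x₀` begins with `w`, whose value is that
of the whole word `x₀ a x₁`; so `f x₀` is a right multiple of `f (x₀ a)` and there is no
`R`-descent. If it lies in the first `w`, then `x₁` ends with the last `w`, and dually there is no
`L`-descent. -/
theorem not_hasGoodFactorization_mul_mul {f : FreeMonoid A →* M} {w t : FreeMonoid A}
    (h : f w = f (w * t * w)) : ¬ HasGoodFactorization f (w * t * w) := by
  rintro ⟨x₀, a, x₁, hg, hx⟩
  rw [hx] at h
  rw [mul_assoc] at hx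
  rcases split_mul hx with ⟨s, rfl, -⟩ | ⟨s, hw, rfl⟩
  · refine hg.1.2 (Or.inr ⟨f (x₁ * s), ?_⟩)
    conv_lhs => rw [map_mul, h]
    simp only [map_mul, mul_assoc]
  · refine hg.2.2 (Or.inr ⟨f (s * t * x₀), ?_⟩)
    conv_lhs => rw [map_mul, map_mul, h]
    simp only [map_mul, mul_assoc]

end Expansion

/-- The words that represent products of regular elements of the Pin–Thérien expansion have no
good factorizations. -/
theorem not_hasGoodFactorization_of_mem_closure {A S : Type u} [Semigroup S]
    (φ : FreeSemigroup A →ₙ* S) {s : PTExpansion φ}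
    (hs : s ∈ Subsemigroup.closure {s : PTExpansion φ | IsRegularElt s}) :
    ∀ w : FreeSemigroup A, s = (w : PTExpansion φ) →
      ¬ HasGoodFactorization (extI φ) w.toFreeMonoid := by
  induction hs using Subsemigroup.closure_induction with
  | mem s hs =>
    rintro w rfl hw
    obtain ⟨t, ht⟩ := hs
    obtain ⟨t, rfl⟩ := Quot.exists_rep t
    have h := (Con.eq _).1 (show (w : PTExpansion φ) = ((w * t * w : FreeSemigroup A) : _) from ht)
    have h' : ptCon (extI φ) w.toFreeMonoid
        (w.toFreeMonoid * t.toFreeMonoid * w.toFreeMonoid) := by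
      simpa only [ptConSemigroup, Con.comap_rel, map_mul] using h
    exact not_hasGoodFactorization_mul_mul h'.1 (h'.2.1.hasGoodFactorization hw)
  | mul x y _ _ hx hy =>
    intro w hw hg
    obtain ⟨v, rfl⟩ := Quot.exists_rep x
    obtain ⟨z, rfl⟩ := Quot.exists_rep y
    have h := (Con.eq _).1 (show ((v * z : FreeSemigroup A) : PTExpansion φ) = w from hw)
    have h' : ptCon (extI φ) (v.toFreeMonoid * z.toFreeMonoid) w.toFreeMonoid := by
      simpa only [ptConSemigroup, Con.comap_rel, map_mul] using h
    rcases (h'.2.2.hasGoodFactorization hg).of_mul with h | h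
    · exact hx v rfl h
    · exact hy z rfl h

/-- The projection of the Pin–Thérien expansion of `S` to `S`. -/
def PTExpansion.toBase {A S : Type u} [Semigroup S] (φ : FreeSemigroup A →ₙ* S) :
    PTExpansion φ →ₙ* S where
  toFun q := Con.liftOn q φ fun v w h => by
    have := h.1
    rw [extI_toFreeMonoid, extI_toFreeMonoid] at this
    exact WithOne.coe_injective this
  map_mul' p q := by
    induction p, q using Con.induction_on₂ with
    | _ a b => exact map_mul φ a b

/-- The projection of the Pin–Thérien expansion is injective on products of regular elements. -/
theorem PTExpansion.eq_of_mem_closure {A S : Type u} [Semigroup S] (φ : FreeSemigroup A →ₙ* S)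
    {s t : PTExpansion φ}
    (hs : s ∈ Subsemigroup.closure {s : PTExpansion φ | IsRegularElt s})
    (ht : t ∈ Subsemigroup.closure {s : PTExpansion φ | IsRegularElt s})
    (h : toBase φ s = toBase φ t) : s = t := by
  obtain ⟨v, rfl⟩ := Quot.exists_rep s
  obtain ⟨w, rfl⟩ := Quot.exists_rep t
  have hv := not_hasGoodFactorization_of_mem_closure φ hs v rfl
  have hw := not_hasGoodFactorization_of_mem_closure φ ht w rfl
  have h' : φ v = φ w := h
  refine (Con.eq (ptConSemigroup φ)).2 ⟨?_, ?_, ?_⟩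
  · rw [extI_toFreeMonoid, extI_toFreeMonoid, h']
  · exact fun x₀ a x₁ hg hx => (hv ⟨x₀, a, x₁, hg, hx⟩).elim
  · exact fun x₀ a x₁ hg hx => (hw ⟨x₀, a, x₁, hg, hx⟩).elim

/-! ### Pseudoidentities valid in `V_bd`. -/

theorem Pseudovariety.mem_bd_ptExpansion {V : Pseudovariety.{u}} {A S : Type u} [Finite A]
    [Semigroup S] {φ : FreeSemigroup A →ₙ* S} (hS : V.mem S) (hφ : Function.Surjective φ) :
    V.bd.mem (PTExpansion φ) :=
  fun _ hW => hW A S φ hS hφ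

theorem bd_models {V : Pseudovariety.{u}} {X : Type u} {π ρ : Pseudoword X}
    (hπ : IsMultiregular V.bd π) (hρ : IsMultiregular V.bd ρ) (h : V.Models π ρ) :
    V.bd.Models π ρ := by
  intro T _ _ hT
  -- By minimality of `V.bd` it suffices that the pseudovariety defined by `π = ρ` contains the
  -- generating expansions.
  refine (hT (modelsPseudovariety π ρ) fun A _ S _ φ hS hφ => ?_).2
  have hfS : Finite S := V.finite_of_mem S hS
  have hE := V.mem_bd_ptExpansion hS hφ
  have hfE : Finite (PTExpansion φ) := V.bd.finite_of_mem _ hE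
  refine ⟨hfE, fun ψ => ?_⟩
  refine PTExpansion.eq_of_mem_closure φ (hπ.lift_mem hE hfE ψ) (hρ.lift_mem hE hfE ψ) ?_
  have := fun x => FreePro.map_lift (V := allFinite) hfE hfS (PTExpansion.toBase φ) ψ _
    (fun _ => rfl) x
  rw [this, this]
  exact h S hS _

/-! ### Words -/

section Words

variable {A : Type u}

theorem eq_one_or_exists_toFreeMonoid (x : FreeMonoid A) :
    x = 1 ∨ ∃ w : FreeSemigroup A, x = w.toFreeMonoid := by
  induction x using FreeMonoid.recOn with
  | one => exact Or.inl rfl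
  | of_mul a x hx =>
    right
    rcases hx with rfl | ⟨w, rfl⟩
    · exact ⟨FreeSemigroup.of a, by simp⟩
    · exact ⟨FreeSemigroup.of a * w, by simp⟩

theorem toFreeMonoid_ne_one (w : FreeSemigroup A) : w.toFreeMonoid ≠ 1 := by
  intro h
  have := congrArg FreeMonoid.length h
  simp at this

theorem IsPrefixCode.eq_one {L : Set (FreeMonoid A)} (hL : IsPrefixCode L) {u z : FreeMonoid A}
    (hu : u ∈ L) (huz : u * z ∈ L) : z = 1 := by
  rcases eq_one_or_exists_toFreeMonoid z with h | ⟨w, rfl⟩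
  · exact h
  · exact (hL u hu w huz).elim

theorem IsSuffixCode.eq_one {L : Set (FreeMonoid A)} (hL : IsSuffixCode L) {u z : FreeMonoid A}
    (hu : u ∈ L) (hzu : z * u ∈ L) : z = 1 := by
  rcases eq_one_or_exists_toFreeMonoid z with h | ⟨w, rfl⟩
  · exact h
  · exact (hL u hu w hzu).elim

theorem exists_of_mul_eq_mul {x y z w : FreeMonoid A} (h : x * y = z * w) :
    (∃ t, z = x * t ∧ y = t * w) ∨ ∃ t, x = z * t ∧ w = t * y := by
  have h' : FreeMonoid.toList x ++ FreeMonoid.toList y =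
      FreeMonoid.toList z ++ FreeMonoid.toList w := congrArg FreeMonoid.toList h
  rcases List.append_eq_append_iff.1 h' with ⟨t, h1, h2⟩ | ⟨t, h1, h2⟩
  · exact Or.inl ⟨FreeMonoid.ofList t, h1, h2⟩
  · exact Or.inr ⟨FreeMonoid.ofList t, h1, h2⟩

/-- Two prefixes of one word are comparable, and a prefix code has no distinct comparable elements.
-/
theorem IsPrefixCode.eq_of_mul_eq_mul {L : Set (FreeMonoid A)} (hL : IsPrefixCode L)
    {u v z w : FreeMonoid A} (hu : u ∈ L) (hv : v ∈ L) (h : u * z = v * w) : u = v := by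
  rcases exists_of_mul_eq_mul h with ⟨t, rfl, -⟩ | ⟨t, rfl, -⟩
  · rw [hL.eq_one hu hv, mul_one]
  · rw [hL.eq_one hv hu, mul_one]

theorem IsSuffixCode.eq_of_mul_eq_mul {L : Set (FreeMonoid A)} (hL : IsSuffixCode L)
    {u v z w : FreeMonoid A} (hu : u ∈ L) (hv : v ∈ L) (h : z * u = w * v) : u = v := by
  rcases exists_of_mul_eq_mul h with ⟨t, -, rfl⟩ | ⟨t, -, rfl⟩
  · rw [hL.eq_one hv hu, one_mul]
  · rw [hL.eq_one hu hv, one_mul]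

end Words

/-! ### Syntactic congruences -/

/-- The syntactic congruence on `A⁺` of a language of `A*`. -/
def syntacticCon {A : Type u} (P : Set (FreeMonoid A)) : Con (FreeSemigroup A) where
  r u v := ∀ p q : FreeMonoid A, p * u.toFreeMonoid * q ∈ P ↔ p * v.toFreeMonoid * q ∈ P
  iseqv :=
    { refl := fun _ _ _ => Iff.rfl
      symm := fun h p q => (h p q).symm
      trans := fun h h' p q => (h p q).trans (h' p q) }
  mul' := by
    intro w x y z h h' p q
    have h₁ := h p (y.toFreeMonoid * q)
    have h₂ := h' (p * x.toFreeMonoid) q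
    simp only [map_mul, ← mul_assoc] at h₁ h₂ ⊢
    exact h₁.trans h₂

theorem Recognizable.ker_le_syntacticCon {A S : Type u} [Semigroup S] {φ : FreeSemigroup A →ₙ* S}
    {L : Set (FreeSemigroup A)} (hL : L = φ ⁻¹' (φ '' L)) :
    Con.ker φ ≤ syntacticCon (FreeSemigroup.toFreeMonoid '' L) := by
  have key : ∀ u v : FreeSemigroup A, φ u = φ v → ∀ p q : FreeMonoid A,
      p * u.toFreeMonoid * q ∈ FreeSemigroup.toFreeMonoid '' L →
        p * v.toFreeMonoid * q ∈ FreeSemigroup.toFreeMonoid '' L := by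
    rintro u v huv p q ⟨w, hw, hwe⟩
    -- The contexts `p`, `q` may be empty, so the values are computed in `Sᴵ`, where the adjoined
    -- identity is distinct from every element of `S`.
    have h : (φ w : WithOne S) = extI φ (p * v.toFreeMonoid * q) := by
      rw [← extI_toFreeMonoid, hwe]
      simp only [map_mul, extI_toFreeMonoid, huv]
    rcases eq_one_or_exists_toFreeMonoid (p * v.toFreeMonoid * q) with h' | ⟨z, hz⟩
    · rw [h', map_one] at h
      exact (WithOne.coe_ne_one h).elim
    · rw [hz, extI_toFreeMonoid] at h
      refine ⟨z, ?_, hz.symm⟩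
      rw [hL]
      exact ⟨w, hw, WithOne.coe_injective h⟩
  exact fun u v h p q => ⟨key u v h p q, key v u h.symm p q⟩

theorem PlusRecognizable.exists_ker_le {V : Pseudovariety.{u}} {A : Type u}
    {L : Set (FreeMonoid A)} (h : PlusRecognizable V L) :
    ∃ (S : Type u) (_ : Semigroup S) (φ : FreeSemigroup A →ₙ* S), V.mem S ∧
      Con.ker φ ≤ syntacticCon L := by
  obtain ⟨L', ⟨S, hS, φ, hV, hL'⟩, rfl⟩ := h
  exact ⟨S, hS, φ, hV, Recognizable.ker_le_syntacticCon hL'⟩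

theorem syntacticCon_singleton_one {A : Type u} : syntacticCon ({1} : Set (FreeMonoid A)) = ⊤ := by
  have key : ∀ (w : FreeSemigroup A) (p q : FreeMonoid A), p * w.toFreeMonoid * q ≠ 1 := by
    intro w p q h
    have := congrArg FreeMonoid.length h
    simp [FreeMonoid.length_mul] at this
  refine top_le_iff.1 fun u v _ p q => ?_
  simp only [Set.mem_singleton_iff, key]

/-- This absorbs the exceptional language `{1}`: its syntactic congruence on nonempty words is
universal, so the trivial semigroup serves for it. -/
theorem exists_ker_le_syntacticCon {V : Pseudovariety.{u}} {A : Type u} {L : Set (FreeMonoid A)}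
    (h : PlusRecognizable V L ∨ L = {1}) :
    ∃ (S : Type u) (_ : Semigroup S) (φ : FreeSemigroup A →ₙ* S), V.mem S ∧
      Con.ker φ ≤ syntacticCon L := by
  rcases h with h | rfl
  · exact h.exists_ker_le
  · exact ⟨PUnit, inferInstance, { toFun := fun _ => PUnit.unit, map_mul' := fun _ _ => rfl },
      V.unit_mem, by rw [syntacticCon_singleton_one]; exact le_top⟩

theorem PlusRecognizable.mem_syntacticCon {V : Pseudovariety.{u}} {A : Type u}
    {L : Set (FreeMonoid A)} (h : PlusRecognizable V L) : V.mem (syntacticCon L).Quotient := by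
  obtain ⟨S, _, φ, hS, hle⟩ := h.exists_ker_le
  refine V.image_mem (Con.ker φ).Quotient _
    { toFun := fun q => Con.liftOn q (fun w : FreeSemigroup A => (w : (syntacticCon L).Quotient))
        fun _ _ h => (Con.eq (syntacticCon L)).2 (hle h)
      map_mul' := fun p q => by
        induction p, q using Con.induction_on₂ with
        | _ a b => rfl }
    (fun q => ?_) (FreePro.kerCong hS φ).2
  obtain ⟨w, rfl⟩ := Quot.exists_rep q
  exact ⟨(w : (Con.ker φ).Quotient), rfl⟩

/-- The syntactic congruence relates nonempty words only and cannot detect whether the empty word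
belongs to `L`; hence the assumption `h₁`. -/
theorem plusRecognizable_of_mem_syntacticCon {V : Pseudovariety.{u}} {A : Type u}
    {L : Set (FreeMonoid A)} (h₁ : (1 : FreeMonoid A) ∉ L) (h : V.mem (syntacticCon L).Quotient) :
    PlusRecognizable V L := by
  refine ⟨FreeSemigroup.toFreeMonoid ⁻¹' L, ⟨(syntacticCon L).Quotient, inferInstance,
    { toFun := fun w => (w : (syntacticCon L).Quotient), map_mul' := fun _ _ => rfl }, h, ?_⟩, ?_⟩
  · refine (Set.subset_preimage_image _ _).antisymm ?_
    rintro w ⟨v, hv, hvw⟩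
    have := ((Con.eq (syntacticCon L)).1 hvw) 1 1
    simp only [one_mul, mul_one] at this
    exact this.1 hv
  · ext x
    constructor
    · intro hx
      rcases eq_one_or_exists_toFreeMonoid x with rfl | ⟨w, rfl⟩
      · exact (h₁ hx).elim
      · exact ⟨w, hx, rfl⟩
    · rintro ⟨w, hw, rfl⟩
      exact hw

/-! ### Bideterministic products -/

section Bideterministic

variable {A : Type u}

/-- The word `w` has a factorization `x₀ a x₁` that makes `p w q` an element of `LaK`. -/
def HasInnerFactorization (L K : Set (FreeMonoid A)) (a : A) (p w q : FreeMonoid A) : Prop :=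
  ∃ x₀ x₁, w = x₀ * FreeMonoid.of a * x₁ ∧ p * x₀ ∈ L ∧ x₁ * q ∈ K

variable {L K : Set (FreeMonoid A)} {a : A}

theorem mem_product_iff {x : FreeMonoid A} :
    x ∈ L * {FreeMonoid.of a} * K ↔ ∃ x₀ ∈ L, ∃ x₁ ∈ K, x = x₀ * FreeMonoid.of a * x₁ := by
  simp only [Set.mem_mul, Set.mem_singleton_iff]
  constructor
  · rintro ⟨_, ⟨x₀, h₀, _, rfl, rfl⟩, x₁, h₁, rfl⟩
    exact ⟨x₀, h₀, x₁, h₁, rfl⟩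
  · rintro ⟨x₀, h₀, x₁, h₁, rfl⟩
    exact ⟨_, ⟨x₀, h₀, _, rfl, rfl⟩, x₁, h₁, rfl⟩

theorem mul_letter_mem {x : FreeMonoid A} (hx : x ∈ L) :
    x * FreeMonoid.of a ∈ L * {FreeMonoid.of a} :=
  Set.mul_mem_mul hx rfl

theorem letter_mul_mem {x : FreeMonoid A} (hx : x ∈ K) :
    FreeMonoid.of a * x ∈ ({FreeMonoid.of a} : Set (FreeMonoid A)) * K :=
  Set.mul_mem_mul rfl hx

theorem one_notMem_product : (1 : FreeMonoid A) ∉ L * {FreeMonoid.of a} * K := by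
  rw [mem_product_iff]
  rintro ⟨x₀, -, x₁, -, h⟩
  have := congrArg FreeMonoid.length h
  simp only [FreeMonoid.length_mul, FreeMonoid.length_of, FreeMonoid.length_one] at this
  omega

/-- The three cases are the possible positions of the marked letter: in `p`, in `w` or in `q`. -/
theorem mul_mul_mem_product_cases {p w q : FreeMonoid A}
    (h : p * w * q ∈ L * {FreeMonoid.of a} * K) :
    (∃ x₀ ∈ L, ∃ t, p = x₀ * FreeMonoid.of a * t ∧ t * w * q ∈ K) ∨
      HasInnerFactorization L K a p w q ∨
      ∃ x₁ ∈ K, ∃ t, q = t * FreeMonoid.of a * x₁ ∧ p * w * t ∈ L := by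
  obtain ⟨x₀, h₀, x₁, h₁, h⟩ := mem_product_iff.1 h
  rw [mul_assoc] at h
  rcases split_mul h with ⟨t, rfl, h'⟩ | ⟨t, rfl, rfl⟩
  · rcases split_mul h' with ⟨s, rfl, rfl⟩ | ⟨s, rfl, rfl⟩
    · exact Or.inr (Or.inr ⟨x₁, h₁, s, rfl, by rwa [mul_assoc]⟩)
    · exact Or.inr (Or.inl ⟨t, s, rfl, h₀, h₁⟩)
  · exact Or.inl ⟨x₀, h₀, t, rfl, by rwa [mul_assoc]⟩

theorem HasInnerFactorization.mem {p w q : FreeMonoid A}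
    (h : HasInnerFactorization L K a p w q) : p * w * q ∈ L * {FreeMonoid.of a} * K := by
  obtain ⟨x₀, x₁, rfl, h₀, h₁⟩ := h
  exact mem_product_iff.2 ⟨_, h₀, _, h₁, by simp only [mul_assoc]⟩

theorem HasInnerFactorization.of_mul {p x y q : FreeMonoid A}
    (h : HasInnerFactorization L K a p (x * y) q) :
    HasInnerFactorization L K a p x (y * q) ∨ HasInnerFactorization L K a (p * x) y q := by
  obtain ⟨x₀, x₁, h, h₀, h₁⟩ := h
  rcases split_mul h with ⟨t, rfl, rfl⟩ | ⟨t, rfl, rfl⟩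
  · exact Or.inr ⟨t, x₁, rfl, by rwa [mul_assoc], h₁⟩
  · exact Or.inl ⟨x₀, t, rfl, h₀, by rwa [← mul_assoc]⟩

/-- Equivalence puts `p v q` in `LaK`; only the position of the marked letter is in question. Were
it in `p`, an element of `La` would be a prefix of `p`, hence a proper prefix of `p x₀ a`, which is
also in `La`. The suffix code `aK` dually excludes `q`. -/
theorem HasInnerFactorization.congr (hL : IsPrefixCode (L * {FreeMonoid.of a}))
    (hK : IsSuffixCode ({FreeMonoid.of a} * K)) {u v : FreeSemigroup A} {p q : FreeMonoid A}
    (huv : syntacticCon (L * {FreeMonoid.of a} * K) u v)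
    (h : HasInnerFactorization L K a p u.toFreeMonoid q) :
    HasInnerFactorization L K a p v.toFreeMonoid q := by
  have hv := (huv p q).1 h.mem
  obtain ⟨x₀, x₁, -, h₀, h₁⟩ := h
  rcases mul_mul_mem_product_cases hv with ⟨y₀, hy, t, rfl, -⟩ | h | ⟨y₁, hy, t, rfl, -⟩
  · have := hL.eq_one (mul_letter_mem hy) (z := t * x₀ * FreeMonoid.of a)
      (by simpa only [mul_assoc] using mul_letter_mem h₀)
    have := congrArg FreeMonoid.length this
    simp [FreeMonoid.length_mul] at this
  · exact h
  · have := hK.eq_one (letter_mul_mem hy) (z := FreeMonoid.of a * x₁ * t)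
      (by simpa only [mul_assoc] using letter_mul_mem h₁)
    have := congrArg FreeMonoid.length this
    simp [FreeMonoid.length_mul] at this

/-- The words that represent regular elements of the syntactic semigroup of a bideterministic
product `LaK` have no inner factorizations. -/
theorem not_hasInnerFactorization_of_regular (hL : IsPrefixCode (L * {FreeMonoid.of a}))
    (hK : IsSuffixCode ({FreeMonoid.of a} * K)) {w t : FreeSemigroup A}
    (hw : syntacticCon (L * {FreeMonoid.of a} * K) w (w * t * w)) (p q : FreeMonoid A) :
    ¬ HasInnerFactorization L K a p w.toFreeMonoid q := by
  intro h
  obtain ⟨y₀, y₁, hy, hy₀, hy₁⟩ := h.congr hL hK hw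
  obtain ⟨x₀, x₁, hx, h₀, h₁⟩ := h
  simp only [map_mul] at hy
  -- Factorize `p w t w` through the first `w` and through the inner factorization of `wtw`: both
  -- begin with an element of `La`, so `x₀` and `y₀` have equal length. Dually, the last `w` in `w t
  -- w q` gives equal lengths for `x₁` and `y₁`. Then `w` and `wtw` would have the same length.
  have e₀ := hL.eq_of_mul_eq_mul (mul_letter_mem h₀) (mul_letter_mem hy₀)
    (z := x₁ * t.toFreeMonoid * w.toFreeMonoid) (w := y₁) (by
      have := congrArg (p * ·) hy
      simpa only [hx, mul_assoc] using this)
  have e₁ := hK.eq_of_mul_eq_mul (letter_mul_mem h₁) (letter_mul_mem hy₁)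
    (z := w.toFreeMonoid * t.toFreeMonoid * x₀) (w := y₀) (by
      have := congrArg (· * q) hy
      simpa only [hx, mul_assoc] using this)
  have l₀ := congrArg FreeMonoid.length e₀
  have l₁ := congrArg FreeMonoid.length e₁
  have l := congrArg FreeMonoid.length hy
  have lx := congrArg FreeMonoid.length hx
  have hl : w.toFreeMonoid.length ≠ 0 := fun h =>
    toFreeMonoid_ne_one w (FreeMonoid.length_eq_zero.1 h)
  simp only [FreeMonoid.length_mul, FreeMonoid.length_of] at l₀ l₁ l lx
  omega

theorem not_hasInnerFactorization_of_mem_closure (hL : IsPrefixCode (L * {FreeMonoid.of a}))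
    (hK : IsSuffixCode ({FreeMonoid.of a} * K))
    {s : (syntacticCon (L * {FreeMonoid.of a} * K)).Quotient}
    (hs : s ∈ Subsemigroup.closure
      {s : (syntacticCon (L * {FreeMonoid.of a} * K)).Quotient | IsRegularElt s}) :
    ∀ w : FreeSemigroup A, s = (w : (syntacticCon (L * {FreeMonoid.of a} * K)).Quotient) →
      ∀ p q, ¬ HasInnerFactorization L K a p w.toFreeMonoid q := by
  induction hs using Subsemigroup.closure_induction with
  | mem s hs =>
    rintro w rfl
    obtain ⟨t, ht⟩ := hs
    obtain ⟨t, rfl⟩ := Quot.exists_rep t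
    exact not_hasInnerFactorization_of_regular hL hK ((Con.eq _).1 ht)
  | mul x y _ _ hx hy =>
    intro w hw p q hg
    obtain ⟨v, rfl⟩ := Quot.exists_rep x
    obtain ⟨z, rfl⟩ := Quot.exists_rep y
    have h : syntacticCon (L * {FreeMonoid.of a} * K) w (v * z) := (Con.eq _).1 hw.symm
    have hg' := hg.congr hL hK h
    rw [map_mul] at hg'
    rcases hg'.of_mul with h | h
    · exact hx v rfl _ _ h
    · exact hy z rfl _ _ h

/-- With the marked letter in `p`, the word `u` sits inside the factor from `K` and can be replaced
by a `K`-equivalent one; with the letter in `q`, the same holds for `L`. -/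
theorem mul_mul_mem_product_of_not_hasInnerFactorization {u v : FreeSemigroup A}
    (hL : syntacticCon L u v) (hK : syntacticCon K u v) {p q : FreeMonoid A}
    (hu : ¬ HasInnerFactorization L K a p u.toFreeMonoid q)
    (h : p * u.toFreeMonoid * q ∈ L * {FreeMonoid.of a} * K) :
    p * v.toFreeMonoid * q ∈ L * {FreeMonoid.of a} * K := by
  rcases mul_mul_mem_product_cases h with ⟨x₀, h₀, t, rfl, ht⟩ | h | ⟨x₁, h₁, t, rfl, ht⟩
  · exact mem_product_iff.2 ⟨x₀, h₀, _, (hK t q).1 ht, by simp only [mul_assoc]⟩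
  · exact (hu h).elim
  · exact mem_product_iff.2 ⟨_, (hL p t).1 ht, x₁, h₁, by simp only [mul_assoc]⟩

/-- A pseudoidentity between pseudowords with multiregular values in the syntactic semigroup of a
bideterministic product `LaK` holds there when it holds in a semigroup recognizing `L` and `K`. -/
theorem models_syntacticCon_product (hL : IsPrefixCode (L * {FreeMonoid.of a}))
    (hK : IsSuffixCode ({FreeMonoid.of a} * K)) {S : Type u} [Semigroup S] [Finite S]
    {φ : FreeSemigroup A →ₙ* S} (hφL : Con.ker φ ≤ syntacticCon L)
    (hφK : Con.ker φ ≤ syntacticCon K) {W : Pseudovariety.{u}}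
    (hW : W.mem (syntacticCon (L * {FreeMonoid.of a} * K)).Quotient)
    [hf : Finite (syntacticCon (L * {FreeMonoid.of a} * K)).Quotient]
    {X : Type u} {π ρ : Pseudoword X} (hπ : IsMultiregular W π) (hρ : IsMultiregular W ρ)
    (hS : Models S π ρ) : Models (syntacticCon (L * {FreeMonoid.of a} * K)).Quotient π ρ := by
  intro ψ
  let M := (syntacticCon (L * {FreeMonoid.of a} * K)).Quotient
  -- Substituting words for the letters of `X` ties the evaluation in `M` to one in `S`.
  choose θ hθ using fun x => Quot.exists_rep (ψ x)
  have hfP : Finite (M × S) := inferInstance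
  let μ : FreeSemigroup A →ₙ* M :=
    { toFun := fun w => (w : (syntacticCon (L * {FreeMonoid.of a} * K)).Quotient)
      map_mul' := fun _ _ => rfl }
  let χ : X → M × S := fun x => (ψ x, φ (θ x))
  have hχ : FreeSemigroup.lift χ = (μ.prod φ).comp (FreeSemigroup.lift θ) := by
    apply FreeSemigroup.hom_ext
    funext x
    simp only [Function.comp_apply, MulHom.comp_apply, FreeSemigroup.lift_of, MulHom.prod_apply]
    exact Prod.ext (hθ x).symm rfl
  have h₁ := fun x => FreePro.map_lift (V := allFinite) hfP hf (MulHom.fst M S) χ ψ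
    (fun _ => rfl) x
  have h₂ := fun x => FreePro.map_lift (V := allFinite) hfP ‹Finite S› (MulHom.snd M S) χ
    (fun x => φ (θ x)) (fun _ => rfl) x
  -- Evaluating in `M × S` yields one word `u` that represents the value of `x` in both factors at
  -- once.
  have key : ∀ x : Pseudoword X, ∃ u : FreeSemigroup A,
      FreePro.lift (V := allFinite) hf ψ x = μ u ∧
      FreePro.lift (V := allFinite) ‹Finite S› (fun x => φ (θ x)) x = φ u := by
    intro x
    obtain ⟨w, hw⟩ := FreePro.exists_word_lift (V := allFinite) hfP χ x
    refine ⟨FreeSemigroup.lift θ w, ?_, ?_⟩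
    · rw [← h₁, hw, hχ]
      rfl
    · rw [← h₂, hw, hχ]
      rfl
  obtain ⟨u, hu, hu'⟩ := key π
  obtain ⟨v, hv, hv'⟩ := key ρ
  have huv : φ u = φ v := by rw [← hu', ← hv', hS]
  have iu := not_hasInnerFactorization_of_mem_closure hL hK (hπ.lift_mem hW hf ψ) u hu
  have iv := not_hasInnerFactorization_of_mem_closure hL hK (hρ.lift_mem hW hf ψ) v hv
  refine hu.trans (Eq.trans ?_ hv.symm)
  refine (Con.eq (syntacticCon (L * {FreeMonoid.of a} * K))).2 fun p q => ⟨?_, ?_⟩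
  · exact mul_mul_mem_product_of_not_hasInnerFactorization (hφL huv) (hφK huv) (iu p q)
  · exact mul_mul_mem_product_of_not_hasInnerFactorization (hφL huv.symm) (hφK huv.symm) (iv p q)

end Bideterministic

/-! ### Transfer of bideterministic closure from `W` to `V`. -/

theorem PlusRecognizable.mono {V W : Pseudovariety.{u}} (h : V ≤ W) {A : Type u}
    {L : Set (FreeMonoid A)} (hL : PlusRecognizable V L) : PlusRecognizable W L := by
  obtain ⟨L', ⟨S, hS, φ, hV, hL'⟩, rfl⟩ := hL
  exact ⟨L', ⟨S, hS, φ, h S hV, hL'⟩, rfl⟩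

theorem ClosedUnderBideterministicProduct.of_multiregularlyBasedIn {V W : Pseudovariety.{u}}
    (h : V ≤ W) (hW : ClosedUnderBideterministicProduct W) (hV : MultiregularlyBasedIn V W) :
    ClosedUnderBideterministicProduct V := by
  obtain ⟨E, hE, hreg⟩ := hV
  intro A _ L K a hL hK hLa haK
  -- Closure of `W` serves to place the syntactic semigroup of `LaK` in `W`, where the two sides of
  -- each basis pseudoidentity take values that are products of regular elements.
  have hM := (hW A L K a (hL.imp_left (.mono h)) (hK.imp_left (.mono h)) hLa haK).mem_syntacticCon
  have hf := W.finite_of_mem _ hM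
  obtain ⟨S, _, φ, hS, hφ⟩ := exists_ker_le_syntacticCon hL
  obtain ⟨T, _, χ, hT, hχ⟩ := exists_ker_le_syntacticCon hK
  -- The product handles `L` and `K` together, and as a member of `V` it satisfies the basis.
  obtain ⟨_, hST⟩ := (hE (S × T)).1 (V.prod_mem S T hS hT)
  refine plusRecognizable_of_mem_syntacticCon one_notMem_product ((hE _).2 ⟨hf, fun e he => ?_⟩)
  exact models_syntacticCon_product hLa haK (φ := φ.prod χ)
    (fun u v huv => hφ (congrArg Prod.fst huv)) (fun u v huv => hχ (congrArg Prod.snd huv))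
    hM (hreg e he).1 (hreg e he).2 (hST e he)

end Bidet

theorem proposition5p6 :
    (∀ (V : Bidet.Pseudovariety.{u}) (X : Type u) [Finite X] (π ρ : Bidet.Pseudoword X),
      Bidet.IsMultiregular V.bd π → Bidet.IsMultiregular V.bd ρ →
      V.Models π ρ → V.bd.Models π ρ) ∧
    (∀ V W : Bidet.Pseudovariety.{u}, V ≤ W →
      Bidet.ClosedUnderBideterministicProduct W →
      Bidet.MultiregularlyBasedIn V W →
      Bidet.ClosedUnderBideterministicProduct V) :=
  ⟨fun _ _ _ _ _ hπ hρ h => Bidet.bd_models hπ hρ h,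
    fun _ _ h hW hV => hW.of_multiregularlyBasedIn h hV⟩
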